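/- For $b>0$ and a real polynomial $p$ put $(\Delta_b p)(x)=\frac{p(x)-p(x-b)}{b}$, and for $n\ge 0$ and real polynomials $p,r$ of degree at most $n$ define the $b$-additive (finite difference) convolution $$ (p\boxplus_b^n r)(x)=\sum_{k=0}^n (\Delta_b^k p)(x)\cdot(\Delta_b^{\,n-k}r)(0). $$ A real polynomial $p$ is called $b$-mesh, written $\operatorname{mesh}(p)\ge b$, if all its complex roots are real and any two of its roots, listed with multiplicity, are at distance at least $b$ (so for $b>0$ the roots are simple; constants, including the zero polynomial, count as $b$-mesh). **Theorem.** Let $b>0$, let $n\ge 0$, and let $p$ and $r$ be real polynomials of degree at most $n$ with $\operatorname{mesh}(p)\ge b$ and $\operatorname{mesh}(r)\ge b$. Then $\operatorname{mesh}(p\boxplus_b^n r)\ge b$; that is, $p\boxplus_b^n r$ is real-rooted with root mesh at least $b$ (or is zero). -/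

import Mathlib

open Polynomial

namespace MeshConvolution

/-- The backward difference operator `Δ_b p (x) = (p(x) - p(x - b)) / b` on real polynomials. -/
noncomputable def backwardDiff (b : ℝ) (p : ℝ[X]) : ℝ[X] :=
  C b⁻¹ * (p - p.comp (X - C b))

/-- The `b`-additive (finite difference) convolution
`p ⊞_b^n r = ∑_{k=0}^n (Δ_b^k p) · (Δ_b^{n-k} r)(0)`. -/
noncomputable def additiveConv (b : ℝ) (n : ℕ) (p r : ℝ[X]) : ℝ[X] :=
  ∑ k ∈ Finset.range (n + 1),
    (backwardDiff b)^[k] p * C (((backwardDiff b)^[n - k] r).eval 0)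

/-- The root mesh of a real polynomial: the least distance `|x - y|` between two of its real roots,
the roots being listed with multiplicity, so that a multiple root gives mesh `0`.
It is `⊤` when there are no two roots to compare. Mathlib's `Polynomial.roots` is empty for the
zero polynomial, whose mesh is therefore `⊤` too. -/
noncomputable def mesh (p : ℝ[X]) : EReal :=
  ⨅ (x : ℝ) (y : ℝ) (_ : ({x, y} : Multiset ℝ) ≤ p.roots), ((|x - y| : ℝ) : EReal)

/-- `p` is `b`-mesh: it is real-rooted (a constant times a product of real linear factors) and its
root mesh is at least `b`. Constants, including `0`, count as real-rooted. -/
def IsMesh (b : ℝ) (p : ℝ[X]) : Prop :=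
  p.Splits ∧ (b : EReal) ≤ mesh p

end MeshConvolution

/-! A nonzero real-rooted `p` has simple roots with gaps larger than `b` exactly when `Δ_b p`
strictly interlaces `p` (`StrictMesh.interlaces_diffLin`, `Interlaces.strictMesh`). Since `Δ_b (p ⊞
r) = (Δ_b p) ⊞ r`, it suffices that convolution with `r` preserves real-rootedness and interlacing.

By partial fractions, a `q` interlacing `p` is `c p` plus a positive combination of the quotients `p
/ (X - a)` over the roots `a`, so only these quotients matter. Induct on `n`
(`StrictMesh.additiveConv_interlaces`): for `p = (X - a) s` of degree `m + 1`,
`additiveConv_X_sub_C_mul` gives `p ⊞^{m+1} r = (X - a) A + B`, with `A = s ⊞^m Δ_b r = s ⊞^{m+1} r`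
and `B = s ⊞^m polarDiff r`. As `-polarDiff r` interlaces `Δ_b r`, induction and symmetry show that
`-B` interlaces `A`; hence `A` interlaces `(X - a) A + B`, which is real-rooted
(`Interlaces.X_sub_C_mul_add`).

Lower degrees reduce to smaller `n` by `p ⊞^{m+1} r = p ⊞^m Δ_b r`. Mesh exactly `b` follows by
using parameters `c < b` and letting `c → b` (`isMesh_of_tendsto`). -/

namespace MeshConvolution

/-! ### Algebra of `Δ_b` and of the convolution. -/

/-- The backward difference operator as a linear map. -/
noncomputable def diffLin (b : ℝ) : ℝ[X] →ₗ[ℝ] ℝ[X] where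
  toFun := backwardDiff b
  map_add' p q := by simp only [backwardDiff, add_comp]; ring
  map_smul' c p := by
    simp only [backwardDiff, smul_eq_C_mul, mul_comp, C_comp, RingHom.id_apply]; ring

theorem linearMap_C_mul (L : ℝ[X] →ₗ[ℝ] ℝ[X]) (c : ℝ) (p : ℝ[X]) : L (C c * p) = C c * L p := by
  rw [← smul_eq_C_mul, map_smul, smul_eq_C_mul]

theorem iterate_backwardDiff (b : ℝ) (k : ℕ) (p : ℝ[X]) :
    (backwardDiff b)^[k] p = (diffLin b ^ k) p := by
  rw [Module.End.pow_apply]; rfl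

theorem diffLin_apply (b : ℝ) (p : ℝ[X]) :
    diffLin b p = C b⁻¹ * (p - p.comp (X - C b)) := rfl

theorem pow_diffLin_succ (b : ℝ) (k : ℕ) (p : ℝ[X]) :
    (diffLin b ^ (k + 1)) p = (diffLin b ^ k) (diffLin b p) := by
  rw [pow_succ]; rfl

theorem pow_diffLin_succ' (b : ℝ) (k : ℕ) (p : ℝ[X]) :
    (diffLin b ^ (k + 1)) p = diffLin b ((diffLin b ^ k) p) := by
  rw [pow_succ']; rfl

theorem additiveConv_eq (b : ℝ) (n : ℕ) (p r : ℝ[X]) :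
    additiveConv b n p r = ∑ k ∈ Finset.range (n + 1),
      (diffLin b ^ k) p * C (((diffLin b ^ (n - k)) r).eval 0) := by
  simp only [additiveConv, iterate_backwardDiff]

/-- The convolution as a linear map in its first argument. -/
noncomputable def convLin (b : ℝ) (n : ℕ) (r : ℝ[X]) : ℝ[X] →ₗ[ℝ] ℝ[X] :=
  ∑ k ∈ Finset.range (n + 1), (((diffLin b ^ (n - k)) r).eval 0) • diffLin b ^ k

theorem convLin_apply (b : ℝ) (n : ℕ) (p r : ℝ[X]) :
    convLin b n r p = additiveConv b n p r := by
  simp [convLin, additiveConv_eq, LinearMap.sum_apply, smul_eq_C_mul, mul_comm]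

theorem comp_shift_eq {b : ℝ} (hb : b ≠ 0) (p : ℝ[X]) :
    p.comp (X - C b) = p - C b * diffLin b p := by
  rw [diffLin_apply, ← mul_assoc, ← C_mul, mul_inv_cancel₀ hb, C_1]; ring

theorem eval_diffLin (b : ℝ) (p : ℝ[X]) (x : ℝ) :
    (diffLin b p).eval x = b⁻¹ * (p.eval x - p.eval (x - b)) := by
  simp [diffLin_apply]

theorem eval_sub_eq {b : ℝ} (hb : b ≠ 0) (p : ℝ[X]) (x : ℝ) :
    p.eval (x - b) = p.eval x - b * (diffLin b p).eval x := by
  rw [eval_diffLin]; field_simp; ring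

theorem diffLin_X_sub_C_mul {b : ℝ} (hb : b ≠ 0) (a : ℝ) (s : ℝ[X]) :
    diffLin b ((X - C a) * s) = (X - C a) * diffLin b s + (s - C b * diffLin b s) := by
  have h : C b⁻¹ * C b = (1 : ℝ[X]) := by rw [← C_mul, inv_mul_cancel₀ hb, C_1]
  rw [← comp_shift_eq hb, diffLin_apply, diffLin_apply]
  simp only [mul_comp, sub_comp, X_comp, C_comp]
  linear_combination (s.comp (X - C b)) * h

theorem diffLin_C (b c : ℝ) : diffLin b (C c) = 0 := by
  simp [diffLin_apply]

/-- Induction by splitting off a factor `X`: the product rule adds one copy of the top coefficient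
at each step, as for the derivative. -/
theorem diffLin_natDegree_coeff {b : ℝ} (hb : b ≠ 0) (n : ℕ) :
    ∀ p : ℝ[X], p.natDegree ≤ n + 1 →
      (diffLin b p).natDegree ≤ n ∧ (diffLin b p).coeff n = (n + 1) * p.coeff (n + 1) := by
  induction n with
  | zero =>
    intro p hp
    rw [eq_X_add_C_of_natDegree_le_one hp]
    have h : diffLin b (C (p.coeff 1) * X + C (p.coeff 0)) = C (p.coeff 1) := by
      have := diffLin_X_sub_C_mul hb 0 (C (p.coeff 1))
      rw [map_add, diffLin_C, mul_comm, add_zero]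
      simpa [diffLin_C] using this
    rw [h]
    simp
  | succ n ih =>
    intro p hp
    have hp' : p = (X - C 0) * p.divX + C (p.coeff 0) := by
      rw [C_0, sub_zero, X_mul_divX_add]
    have ht : p.divX.natDegree ≤ n + 1 := by rw [natDegree_divX_eq_natDegree_tsub_one]; omega
    obtain ⟨h1, h2⟩ := ih _ ht
    have h : diffLin b p = X * diffLin b p.divX + (p.divX - C b * diffLin b p.divX) := by
      conv_lhs => rw [hp']
      rw [map_add, diffLin_C, diffLin_X_sub_C_mul hb]
      simp
    rw [h]
    constructor
    · refine natDegree_add_le_of_degree_le ?_ ((natDegree_sub_le _ _).trans (max_le ht ?_))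
      · exact natDegree_mul_le_of_le natDegree_X_le h1 |>.trans (by omega)
      · exact (natDegree_C_mul_le _ _).trans (h1.trans (by omega))
    · rw [coeff_add, coeff_X_mul, h2, coeff_sub, coeff_C_mul,
        coeff_eq_zero_of_natDegree_lt (Nat.lt_succ_of_le h1), coeff_divX]
      push_cast; ring

theorem natDegree_diffLin_le {b : ℝ} (hb : b ≠ 0) (p : ℝ[X]) :
    (diffLin b p).natDegree ≤ p.natDegree - 1 := by
  rcases Nat.eq_zero_or_pos p.natDegree with h | h
  · rw [eq_C_of_natDegree_eq_zero h, diffLin_C]; simp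
  · exact (diffLin_natDegree_coeff hb (p.natDegree - 1) p (by omega)).1

theorem natDegree_diffLin {b : ℝ} (hb : b ≠ 0) {n : ℕ} {p : ℝ[X]} (hp : p.natDegree = n + 1) :
    (diffLin b p).natDegree = n := by
  obtain ⟨h1, h2⟩ := diffLin_natDegree_coeff hb n p hp.le
  refine le_antisymm h1 (le_natDegree_of_ne_zero ?_)
  rw [h2, ← hp]
  have : p ≠ 0 := by rintro rfl; simp at hp
  exact mul_ne_zero (by positivity) (leadingCoeff_ne_zero.mpr this)

theorem diffLin_eq_zero {b : ℝ} {p : ℝ[X]} (hp : p.natDegree = 0) : diffLin b p = 0 := by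
  rw [eq_C_of_natDegree_eq_zero hp, diffLin_C]

theorem pow_diffLin_eq_zero {b : ℝ} (hb : b ≠ 0) (k : ℕ) :
    ∀ p : ℝ[X], p.natDegree < k → (diffLin b ^ k) p = 0 := by
  induction k with
  | zero => intro p hp; omega
  | succ k ih =>
    intro p hp
    rw [pow_diffLin_succ]
    rcases Nat.eq_zero_or_pos p.natDegree with h | h
    · rw [diffLin_eq_zero h, map_zero]
    · exact ih _ ((natDegree_diffLin_le hb p).trans_lt (by omega))

theorem natDegree_pow_diffLin_le {b : ℝ} (hb : b ≠ 0) (k : ℕ) (p : ℝ[X]) :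
    ((diffLin b ^ k) p).natDegree ≤ p.natDegree := by
  induction k with
  | zero => simp
  | succ k ih =>
    rw [pow_diffLin_succ']
    exact (natDegree_diffLin_le hb _).trans ((Nat.sub_le _ _).trans ih)

theorem natDegree_additiveConv_le {b : ℝ} (hb : b ≠ 0) (n : ℕ) (p r : ℝ[X]) :
    (additiveConv b n p r).natDegree ≤ p.natDegree := by
  rw [additiveConv_eq]
  refine natDegree_sum_le_of_forall_le _ _ fun k _ => ?_
  exact (natDegree_mul_C_le _ _).trans (natDegree_pow_diffLin_le hb k p)

theorem diffLin_additiveConv (b : ℝ) (n : ℕ) (p r : ℝ[X]) :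
    diffLin b (additiveConv b n p r) = additiveConv b n (diffLin b p) r := by
  simp only [additiveConv_eq, map_sum]
  refine Finset.sum_congr rfl fun k _ => ?_
  rw [mul_comm, linearMap_C_mul, mul_comm, ← pow_diffLin_succ',
    pow_diffLin_succ]

theorem additiveConv_succ_left {b : ℝ} (hb : b ≠ 0) {m : ℕ} {p : ℝ[X]} (hp : p.natDegree ≤ m)
    (r : ℝ[X]) : additiveConv b (m + 1) p r = additiveConv b m p (diffLin b r) := by
  rw [additiveConv_eq, additiveConv_eq, Finset.sum_range_succ,
    pow_diffLin_eq_zero hb (m + 1) p (by omega), zero_mul, add_zero]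
  refine Finset.sum_congr rfl fun k hk => ?_
  rw [← pow_diffLin_succ, Nat.succ_sub (by simpa [Nat.lt_succ_iff] using hk)]

/-- The convolution is symmetric on polynomials of degree at most `n`. -/
theorem additiveConv_comm {b : ℝ} (hb : b ≠ 0) {n : ℕ} {p r : ℝ[X]} (hp : p.natDegree ≤ n)
    (hr : r.natDegree ≤ n) : additiveConv b n p r = additiveConv b n r p := by
  set F : ℝ → ℝ → ℝ := fun x y => ∑ k ∈ Finset.range (n + 1),
    ((diffLin b ^ k) p).eval x * ((diffLin b ^ (n - k)) r).eval y with hF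
  -- The difference telescopes; the boundary terms contain `Δ^(n+1) p` or `Δ^(n+1) r`, which vanish
  -- by degree. Iterating moves shifts from one variable to the other, so the two convolutions agree
  -- at all points `-m b`.
  have hshift : ∀ x y, F (x - b) y = F x (y - b) := by
    intro x y
    rw [← sub_eq_zero, hF]
    simp only [← Finset.sum_sub_distrib, eval_sub_eq hb]
    set g : ℕ → ℝ := fun k => ((diffLin b ^ k) p).eval x * ((diffLin b ^ (n + 1 - k)) r).eval y
    have hg : ∀ k ∈ Finset.range (n + 1),
        (((diffLin b ^ k) p).eval x - b * (diffLin b ((diffLin b ^ k) p)).eval x) *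
          ((diffLin b ^ (n - k)) r).eval y - ((diffLin b ^ k) p).eval x *
          (((diffLin b ^ (n - k)) r).eval y - b * (diffLin b ((diffLin b ^ (n - k)) r)).eval y) =
        -b * (g (k + 1) - g k) := by
      intro k hk
      have hk' : n + 1 - k = n - k + 1 := Nat.succ_sub (by simpa [Nat.lt_succ_iff] using hk)
      simp only [g, Nat.add_sub_add_right, hk', ← pow_diffLin_succ']
      ring
    rw [Finset.sum_congr rfl hg, ← Finset.mul_sum, Finset.sum_range_sub]
    simp [g, pow_diffLin_eq_zero hb (n + 1) p (by omega),
      pow_diffLin_eq_zero hb (n + 1) r (by omega)]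
  have hdiag : ∀ (m : ℕ) (y : ℝ), F (-(m * b)) y = F 0 (y - m * b) := by
    intro m
    induction m with
    | zero => simp
    | succ m ih =>
      intro y
      have : -(((m + 1 : ℕ) : ℝ) * b) = -(m * b) - b := by push_cast; ring
      rw [this, hshift, ih]
      congr 1; push_cast; ring
  have hleft : ∀ x, (additiveConv b n p r).eval x = F x 0 := by
    intro x; simp [additiveConv_eq, eval_finsetSum, hF]
  have hright : ∀ y, (additiveConv b n r p).eval y = F 0 y := by
    intro y
    simp only [additiveConv_eq, eval_finsetSum, hF, eval_mul, eval_C]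
    rw [← Finset.sum_range_reflect]
    refine Finset.sum_congr rfl fun k hk => ?_
    have hk' : k ≤ n := by simpa [Nat.lt_succ_iff] using hk
    rw [mul_comm]
    congr; omega
  refine eq_of_infinite_eval_eq _ _ (Set.Infinite.mono (s := Set.range fun m : ℕ => -((m : ℝ) * b))
    ?_ (Set.infinite_range_of_injective ?_))
  · rintro _ ⟨m, rfl⟩
    simp only [Set.mem_ofPred_eq]
    rw [hleft, hright, hdiag, zero_sub]
  · intro i j h
    simpa [hb] using h

/-- The finite difference analogue of the polar derivative of `r` of order `n`. -/
noncomputable def polarDiff (b : ℝ) (n : ℕ) (r : ℝ[X]) : ℝ[X] :=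
  C (n : ℝ) * (r - C b * diffLin b r) - (X - C b) * diffLin b r

/-- Discrete Leibniz rule for a linear factor; the last bracket is `Δ^k s` translated by `b`. -/
theorem pow_diffLin_X_sub_C_mul {b : ℝ} (hb : b ≠ 0) (a : ℝ) (s : ℝ[X]) (k : ℕ) :
    (diffLin b ^ (k + 1)) ((X - C a) * s) = (X - C a) * (diffLin b ^ (k + 1)) s +
      C ((k : ℝ) + 1) * ((diffLin b ^ k) s - C b * (diffLin b ^ (k + 1)) s) := by
  induction k with
  | zero => simp [diffLin_X_sub_C_mul hb]
  | succ k ih =>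
    rw [pow_diffLin_succ', ih, map_add, diffLin_X_sub_C_mul hb, linearMap_C_mul, map_sub, linearMap_C_mul]
    simp only [← pow_diffLin_succ']
    push_cast
    simp only [C_add, C_1]
    ring

theorem pow_diffLin_polarDiff {b : ℝ} (hb : b ≠ 0) (n : ℕ) (r : ℝ[X]) (j : ℕ) :
    ((diffLin b ^ j) (polarDiff b n r)).eval 0 =
      (n - j) * (((diffLin b ^ j) r).eval 0 - b * ((diffLin b ^ (j + 1)) r).eval 0) +
        b * ((diffLin b ^ (j + 1)) r).eval 0 := by
  rw [polarDiff, map_sub, linearMap_C_mul, map_sub, linearMap_C_mul, ← pow_diffLin_succ]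
  cases j with
  | zero => simp
  | succ j =>
    rw [pow_diffLin_X_sub_C_mul hb]
    simp only [← pow_diffLin_succ, eval_sub, eval_mul, eval_C, eval_add, eval_X]
    push_cast
    ring

/-- Pulling a linear factor out of the first argument of the convolution. -/
theorem additiveConv_X_sub_C_mul {b : ℝ} (hb : b ≠ 0) {m : ℕ} (a : ℝ) {s : ℝ[X]} (r : ℝ[X])
    (hs : s.natDegree ≤ m) :
    additiveConv b (m + 1) ((X - C a) * s) r =
      (X - C a) * additiveConv b m s (diffLin b r) +
        additiveConv b m s (polarDiff b (m + 1) r) := by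
  have hs0 : (diffLin b ^ (m + 1)) s = 0 := pow_diffLin_eq_zero hb _ _ (by omega)
  set σ : ℕ → ℝ[X] := fun k => (diffLin b ^ k) s with hσ
  set ρ : ℕ → ℝ := fun k => ((diffLin b ^ k) r).eval 0 with hρ
  have hA : additiveConv b m s (diffLin b r) =
      ∑ k ∈ Finset.range (m + 1), σ k * C (ρ (m + 1 - k)) := by
    rw [additiveConv_eq]
    refine Finset.sum_congr rfl fun k hk => ?_
    rw [← pow_diffLin_succ, Nat.succ_sub (by simpa [Nat.lt_succ_iff] using hk)]
  have hB : additiveConv b m s (polarDiff b (m + 1) r) = ∑ k ∈ Finset.range (m + 1),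
      (C ((k : ℝ) + 1) * C (ρ (m - k)) * σ k - C b * (C (k : ℝ) * C (ρ (m + 1 - k)) * σ k)) := by
    rw [additiveConv_eq]
    refine Finset.sum_congr rfl fun k hk => ?_
    have hk' : k ≤ m := by simpa [Nat.lt_succ_iff] using hk
    rw [pow_diffLin_polarDiff hb, Nat.succ_sub hk', Nat.cast_sub hk']
    simp only [← C_mul, ← mul_assoc, ← sub_mul, ← C_sub]
    rw [mul_comm]
    congr 2
    simp only [hρ]
    push_cast
    ring
  have hL : additiveConv b (m + 1) ((X - C a) * s) r =
      (X - C a) * ∑ k ∈ Finset.range (m + 1), σ k * C (ρ (m + 1 - k)) +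
        ∑ k ∈ Finset.range (m + 1), (C ((k : ℝ) + 1) * C (ρ (m - k)) * σ k -
          C b * (C ((k : ℝ) + 1) * C (ρ (m - k)) * σ (k + 1))) := by
    have h0 : ∑ k ∈ Finset.range (m + 1), σ k * C (ρ (m + 1 - k)) =
        σ 0 * C (ρ (m + 1)) + ∑ k ∈ Finset.range (m + 1), σ (k + 1) * C (ρ (m - k)) := by
      rw [Finset.sum_range_succ (fun k => σ (k + 1) * C (ρ (m - k))) m, Finset.sum_range_succ']
      simp [hσ, hs0, add_comm]
    rw [h0, additiveConv_eq, Finset.sum_range_succ', mul_add, Finset.mul_sum, add_assoc,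
      ← Finset.sum_add_distrib, add_comm]
    congr 1
    · simp [hσ, hρ]; ring
    · refine Finset.sum_congr rfl fun k _ => ?_
      rw [pow_diffLin_X_sub_C_mul hb, Nat.add_sub_add_right]
      simp only [hσ, hρ]
      ring
  rw [hL, hA, hB]
  congr 1
  rw [Finset.sum_sub_distrib, Finset.sum_sub_distrib, ← Finset.mul_sum, ← Finset.mul_sum]
  congr 2
  -- Index shift `k + 1 → k`: the extra top term has the factor `σ (m + 1) = 0`, the extra bottom
  -- term the coefficient `0`.
  rw [Finset.sum_range_succ, Finset.sum_range_succ']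
  simp [hσ, hs0]

end MeshConvolution

/-! ### Interlacing, partial fractions and Wronskians. -/

namespace MeshConvolution

open ComplexConjugate

/-- `q` strictly interlaces `p` from below: `q / p` decreases through every root of `p`. -/
structure Interlaces (q p : ℝ[X]) : Prop where
  natDegree_le : q.natDegree ≤ p.natDegree
  pos : ∀ x, p.IsRoot x → 0 < q.eval x * p.derivative.eval x

theorem nodup_roots_of_derivative_ne_zero {p : ℝ[X]} (hp0 : p ≠ 0)
    (h : ∀ x, p.IsRoot x → p.derivative.eval x ≠ 0) : p.roots.Nodup := by
  classical
  refine Multiset.nodup_iff_count_le_one.mpr fun x => ?_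
  rw [count_roots]
  by_contra! hx
  obtain ⟨h1, h2⟩ := (one_lt_rootMultiplicity_iff_isRoot hp0).mp hx
  exact h x h1 h2

theorem eval_derivative_eq_eval_divByMonic {p : ℝ[X]} {x : ℝ} (hx : p.IsRoot x) :
    p.derivative.eval x = (p /ₘ (X - C x)).eval x := by
  conv_lhs => rw [← mul_divByMonic_eq_iff_isRoot.mpr hx]
  simp

theorem eval_eq_mul_eval_divByMonic {p : ℝ[X]} {x : ℝ} (hx : p.IsRoot x) (y : ℝ) :
    p.eval y = (y - x) * (p /ₘ (X - C x)).eval y := by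
  conv_lhs => rw [← mul_divByMonic_eq_iff_isRoot.mpr hx]
  simp

/-- The weights are the residues `q(x) / p'(x)`. Subtracting the interpolating sum leaves a
polynomial of degree at most `deg p` vanishing at all the simple roots of `p`, hence a constant
multiple of `p`. -/
theorem Interlaces.exists_partialFraction {p q : ℝ[X]} (hp0 : p ≠ 0) (hp : p.Splits)
    (h : Interlaces q p) : ∃ (c : ℝ) (w : ℝ → ℝ), (∀ x, p.IsRoot x → 0 < w x) ∧
      q = C c * p + ∑ x ∈ p.roots.toFinset, C (w x) * (p /ₘ (X - C x)) := by
  have hder : ∀ x, p.IsRoot x → p.derivative.eval x ≠ 0 := fun x hx h0 => by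
    have := h.pos x hx; simp [h0] at this
  have hnd := nodup_roots_of_derivative_ne_zero hp0 hder
  set w : ℝ → ℝ := fun x => q.eval x / p.derivative.eval x
  have hw : ∀ x, p.IsRoot x → 0 < w x := fun x hx => by
    have h1 := h.pos x hx
    rcases mul_pos_iff.mp h1 with h2 | h2
    · exact div_pos h2.1 h2.2
    · exact div_pos_of_neg_of_neg h2.1 h2.2
  set D := q - ∑ x ∈ p.roots.toFinset, C (w x) * (p /ₘ (X - C x)) with hD
  have hroot : ∀ y, p.IsRoot y → D.IsRoot y := by
    intro y hy
    have hymem : y ∈ p.roots.toFinset := by simpa [hp0] using hy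
    rw [IsRoot, hD, eval_sub, eval_finsetSum, Finset.sum_eq_single_of_mem y hymem]
    · rw [eval_mul, eval_C, ← eval_derivative_eq_eval_divByMonic hy,
        div_mul_cancel₀ _ (hder y hy), sub_self]
    · intro x hx hxy
      have hx' : p.IsRoot x := by simpa [hp0] using hx
      have h1 := eval_eq_mul_eval_divByMonic hx' y
      rw [hy.eq_zero, eq_comm, mul_eq_zero] at h1
      rw [eval_mul, h1.resolve_left (sub_ne_zero.mpr hxy.symm), mul_zero]
  have hdeg : D.natDegree ≤ p.natDegree := by
    refine (natDegree_sub_le _ _).trans (max_le h.natDegree_le ?_)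
    refine natDegree_sum_le_of_forall_le _ _ fun x _ => ?_
    refine (natDegree_C_mul_le _ _).trans ?_
    rw [natDegree_divByMonic _ (monic_X_sub_C x)]
    exact Nat.sub_le _ _
  have hdvd : p ∣ D := by
    rcases eq_or_ne D 0 with h0 | h0
    · rw [h0]; exact dvd_zero _
    · refine (hp.dvd_iff_roots_le_roots hp0 h0).mpr ?_
      refine (Multiset.le_iff_subset hnd).mpr fun y hy => ?_
      rw [mem_roots hp0] at hy
      rw [mem_roots h0]
      exact hroot y hy
  obtain ⟨k, hk⟩ := hdvd
  have hk0 : k.natDegree = 0 := by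
    rcases eq_or_ne k 0 with h0 | h0
    · simp [h0]
    · rw [hk, natDegree_mul hp0 h0] at hdeg; omega
  refine ⟨k.coeff 0, w, hw, ?_⟩
  rw [← eq_C_of_natDegree_eq_zero hk0, mul_comm, ← hk, hD]
  ring

/-- If `p = (X - x) s` then `p' s - p s' = s²`, and the `c p` term drops out. -/
theorem Interlaces.wronskian_eq {p : ℝ[X]} (hp0 : p ≠ 0) (c : ℝ) (w : ℝ → ℝ) (t : ℝ) :
    p.derivative.eval t *
        (C c * p + ∑ x ∈ p.roots.toFinset, C (w x) * (p /ₘ (X - C x))).eval t -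
      p.eval t * (C c * p +
        ∑ x ∈ p.roots.toFinset, C (w x) * (p /ₘ (X - C x))).derivative.eval t =
      ∑ x ∈ p.roots.toFinset, w x * (p /ₘ (X - C x)).eval t ^ 2 := by
  simp only [derivative_add, derivative_sum, derivative_C_mul, eval_add, eval_mul, eval_C,
    eval_finsetSum]
  have : ∀ x ∈ p.roots.toFinset, w x * (p /ₘ (X - C x)).eval t ^ 2 =
      p.derivative.eval t * (w x * (p /ₘ (X - C x)).eval t) -
        p.eval t * (w x * (derivative (p /ₘ (X - C x))).eval t) := by
    intro x hx
    have hx' : p.IsRoot x := by simpa [hp0] using hx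
    have h2 : p.derivative.eval t = (p /ₘ (X - C x)).eval t +
        (t - x) * (derivative (p /ₘ (X - C x))).eval t := by
      conv_lhs => rw [← mul_divByMonic_eq_iff_isRoot.mpr hx']
      simp
    rw [h2, eval_eq_mul_eval_divByMonic hx' t]
    ring
  rw [Finset.sum_congr rfl this, Finset.sum_sub_distrib, ← Finset.mul_sum, ← Finset.mul_sum]
  ring

theorem Interlaces.wronskian_nonneg {p q : ℝ[X]} (hp0 : p ≠ 0) (hp : p.Splits)
    (h : Interlaces q p) (t : ℝ) :
    0 ≤ p.derivative.eval t * q.eval t - p.eval t * q.derivative.eval t := by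
  obtain ⟨c, w, hw, rfl⟩ := h.exists_partialFraction hp0 hp
  rw [Interlaces.wronskian_eq hp0]
  refine Finset.sum_nonneg fun x hx => mul_nonneg (hw x ?_).le (sq_nonneg _)
  simpa [hp0] using hx

theorem Interlaces.wronskian_pos {p q : ℝ[X]} (hp : p.Splits) (hd : p.natDegree ≠ 0)
    (h : Interlaces q p) (t : ℝ) :
    0 < p.derivative.eval t * q.eval t - p.eval t * q.derivative.eval t := by
  have hp0 : p ≠ 0 := by rintro rfl; simp at hd
  have hpos := h.pos
  obtain ⟨c, w, hw, rfl⟩ := h.exists_partialFraction hp0 hp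
  rw [Interlaces.wronskian_eq hp0]
  have hw' : ∀ x ∈ p.roots.toFinset, 0 < w x := fun x hx => hw x (by simpa [hp0] using hx)
  refine Finset.sum_pos' (fun x hx => mul_nonneg (hw' x hx).le (sq_nonneg _)) ?_
  suffices ∃ x, p.IsRoot x ∧ (p /ₘ (X - C x)).eval t ≠ 0 by
    obtain ⟨x, hx, hxt⟩ := this
    exact ⟨x, by simpa [hp0] using hx, mul_pos (hw x hx) (by positivity)⟩
  by_cases ht : p.IsRoot t
  · refine ⟨t, ht, fun h0 => ?_⟩
    have := hpos t ht
    rw [eval_derivative_eq_eval_divByMonic ht, h0, mul_zero] at this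
    exact this.false
  · obtain ⟨x, hx⟩ := hp.exists_eval_eq_zero
      (fun h0 => hd (natDegree_eq_of_degree_eq_some h0))
    refine ⟨x, hx, fun h0 => ht ?_⟩
    rw [IsRoot, eval_eq_mul_eval_divByMonic hx t, h0, mul_zero]

theorem aeval_ne_zero_of_splits {p : ℝ[X]} (hp0 : p ≠ 0) (hp : p.Splits) {z : ℂ} (hz : z.im ≠ 0) :
    aeval z p ≠ 0 := by
  intro h0
  rw [hp.eq_prod_roots] at h0
  simp only [map_mul, aeval_C, map_multiset_prod, Multiset.map_map] at h0
  rcases mul_eq_zero.mp h0 with h1 | h1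
  · exact hp0 (leadingCoeff_eq_zero.mp (by simpa using h1))
  · obtain ⟨x, -, hx⟩ := Multiset.mem_map.mp (Multiset.prod_eq_zero_iff.mp h1)
    apply hz
    have : z = (x : ℂ) := by simpa [sub_eq_zero] using hx
    rw [this, Complex.ofReal_im]

theorem splits_of_forall_aeval_ne_zero {p : ℝ[X]} (h : ∀ z : ℂ, 0 < z.im → aeval z p ≠ 0) :
    p.Splits := by
  refine Splits.of_splits_map (algebraMap ℝ ℂ) (IsAlgClosed.splits _) fun z hz => ?_
  have hz0 : aeval z p = 0 := by
    have := isRoot_of_mem_roots hz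
    rwa [IsRoot, eval_map_algebraMap] at this
  rcases lt_trichotomy z.im 0 with hi | hi | hi
  · refine absurd ?_ (h (conj z) (by simpa using hi))
    rw [aeval_conj, hz0, map_zero]
  · exact ⟨z.re, by apply Complex.ext <;> simp [hi]⟩
  · exact absurd hz0 (h z hi)

/-- This is `|p|² Im (q / p)`, where each `w / (z - x)` has imaginary part of sign opposite to `Im
z`; so `q / p` sends the upper half-plane to the lower one. -/
theorem Interlaces.im_mul_conj_eq {p : ℝ[X]} (hp0 : p ≠ 0) (c : ℝ) (w : ℝ → ℝ) (z : ℂ) :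
    (aeval z (C c * p + ∑ x ∈ p.roots.toFinset, C (w x) * (p /ₘ (X - C x))) *
      conj (aeval z p)).im =
      -(z.im * ∑ x ∈ p.roots.toFinset, w x * Complex.normSq (aeval z (p /ₘ (X - C x)))) := by
  have h1 : ∀ x ∈ p.roots.toFinset, (aeval z (C (w x) * (p /ₘ (X - C x))) * conj (aeval z p)).im =
      -(z.im * (w x * Complex.normSq (aeval z (p /ₘ (X - C x))))) := by
    intro x hx
    have hx' : p.IsRoot x := by simpa [hp0] using hx
    have h2 : aeval z p = (z - x) * aeval z (p /ₘ (X - C x)) := by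
      conv_lhs => rw [← mul_divByMonic_eq_iff_isRoot.mpr hx']
      simp
    rw [h2]
    simp [Complex.normSq_apply]
    ring
  rw [map_add, map_sum, add_mul, Finset.sum_mul, Complex.add_im, Complex.im_sum,
    Finset.sum_congr rfl h1, Finset.sum_neg_distrib, ← Finset.mul_sum]
  simp
  ring

theorem Interlaces.im_nonpos {p q : ℝ[X]} (hp0 : p ≠ 0) (hp : p.Splits) (h : Interlaces q p)
    {z : ℂ} (hz : 0 < z.im) : (aeval z q * conj (aeval z p)).im ≤ 0 := by
  obtain ⟨c, w, hw, rfl⟩ := h.exists_partialFraction hp0 hp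
  rw [Interlaces.im_mul_conj_eq hp0, neg_nonpos]
  refine mul_nonneg hz.le (Finset.sum_nonneg fun x hx => ?_)
  exact mul_nonneg (hw x (by simpa [hp0] using hx)).le (Complex.normSq_nonneg _)

theorem Interlaces.im_neg {p q : ℝ[X]} (hp : p.Splits) (hd : p.natDegree ≠ 0)
    (h : Interlaces q p) {z : ℂ} (hz : 0 < z.im) : (aeval z q * conj (aeval z p)).im < 0 := by
  have hp0 : p ≠ 0 := by rintro rfl; simp at hd
  obtain ⟨c, w, hw, rfl⟩ := h.exists_partialFraction hp0 hp
  rw [Interlaces.im_mul_conj_eq hp0, neg_lt_zero]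
  have hw' : ∀ x ∈ p.roots.toFinset, 0 < w x := fun x hx => hw x (by simpa [hp0] using hx)
  refine mul_pos hz (Finset.sum_pos (fun x hx => mul_pos (hw' x hx) ?_) ?_)
  · have hx' : p.IsRoot x := by simpa [hp0] using hx
    refine Complex.normSq_pos.mpr fun h0 => aeval_ne_zero_of_splits hp0 hp hz.ne' ?_
    rw [← mul_divByMonic_eq_iff_isRoot.mpr hx', map_mul, h0, mul_zero]
  · obtain ⟨x, hx⟩ := hp.exists_eval_eq_zero
      (fun h0 => hd (natDegree_eq_of_degree_eq_some h0))
    exact ⟨x, by simpa [hp0] using hx⟩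

theorem Interlaces.splits {p q : ℝ[X]} (hp : p.Splits) (hd : p.natDegree ≠ 0)
    (h : Interlaces q p) : q.Splits := by
  refine splits_of_forall_aeval_ne_zero fun z hz h0 => ?_
  have := h.im_neg hp hd hz
  simp [h0] at this

/-- If `-B` interlaces `A`, then `A` interlaces `(X - a) A + B`, which is real-rooted. -/
theorem Interlaces.X_sub_C_mul_add {A B : ℝ[X]} (hA0 : A ≠ 0) (hA : A.Splits)
    (h : Interlaces (-B) A) (a : ℝ) :
    ((X - C a) * A + B).natDegree = A.natDegree + 1 ∧ ((X - C a) * A + B).Splits ∧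
      Interlaces A ((X - C a) * A + B) := by
  have hdeg : ((X - C a) * A + B).natDegree = A.natDegree + 1 := by
    have h1 : ((X - C a) * A).natDegree = A.natDegree + 1 := by
      rw [natDegree_mul (X_sub_C_ne_zero a) hA0, natDegree_X_sub_C, add_comm]
    rw [natDegree_add_eq_left_of_natDegree_lt, h1]
    have := h.natDegree_le
    rw [natDegree_neg] at this
    omega
  refine ⟨hdeg, splits_of_forall_aeval_ne_zero fun z hz h0 => ?_, ⟨by omega, fun x hx => ?_⟩⟩
  -- At a zero `z` one has `-B / A = z - a`, whose imaginary part is positive.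
  · have h1 := h.im_nonpos hA0 hA hz
    have h2 : aeval z (-B) = (z - a) * aeval z A := by
      simp at h0
      rw [map_neg]
      linear_combination -h0
    have h3 := Complex.normSq_pos.mpr (aeval_ne_zero_of_splits hA0 hA hz.ne')
    rw [h2, mul_assoc, Complex.mul_conj] at h1
    simp at h1
    nlinarith
  · have hx0 : (x - a) * A.eval x + B.eval x = 0 := by simpa using hx
    have hW := h.wronskian_nonneg hA0 hA x
    have key : A.eval x * ((X - C a) * A + B).derivative.eval x = A.eval x ^ 2 +
        (A.derivative.eval x * (-B).eval x - A.eval x * (-B).derivative.eval x) := by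
      simp
      linear_combination (A.derivative.eval x) * hx0
    rw [key]
    -- For constant `A` the Wronskian may vanish and `A²` gives positivity; otherwise the Wronskian
    -- does.
    by_cases hd : A.natDegree = 0
    · have : A.eval x ≠ 0 := by
        rw [eq_C_of_natDegree_eq_zero hd] at hA0 ⊢
        simpa using hA0
      positivity
    · have := h.wronskian_pos hA hd x
      positivity

theorem div_lt_div_of_wronskian_pos {p q : ℝ[X]} {x y : ℝ} (hxy : x < y)
    (hp : ∀ t ∈ Set.Icc x y, p.eval t ≠ 0)
    (hW : ∀ t, 0 < p.derivative.eval t * q.eval t - p.eval t * q.derivative.eval t) :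
    q.eval y / p.eval y < q.eval x / p.eval x := by
  have hd : ∀ t ∈ Set.Icc x y, HasDerivAt (fun t => q.eval t / p.eval t)
      ((q.derivative.eval t * p.eval t - q.eval t * p.derivative.eval t) / p.eval t ^ 2) t :=
    fun t ht => (q.hasDerivAt t).div (p.hasDerivAt t) (hp t ht)
  refine strictAntiOn_of_deriv_neg (convex_Icc x y)
    (fun t ht => (hd t ht).continuousAt.continuousWithinAt) (fun t ht => ?_)
    (Set.left_mem_Icc.mpr hxy.le) (Set.right_mem_Icc.mpr hxy.le) hxy
  have ht' := interior_subset ht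
  rw [(hd t ht').deriv]
  have := hp t ht'
  refine div_neg_of_neg_of_pos ?_ (by positivity)
  linarith [hW t]

/-- Without such a root, `q / p` would decrease strictly from `0` to `0`. -/
theorem exists_root_of_wronskian_pos {p q : ℝ[X]} {x y : ℝ} (hxy : x < y)
    (hW : ∀ t, 0 < p.derivative.eval t * q.eval t - p.eval t * q.derivative.eval t)
    (hx : q.IsRoot x) (hy : q.IsRoot y) : ∃ t ∈ Set.Icc x y, p.IsRoot t := by
  by_contra! hp
  have := div_lt_div_of_wronskian_pos hxy hp hW
  rw [hx.eq_zero, hy.eq_zero, zero_div, zero_div] at this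
  exact this.false

/-! ### Mesh as interlacing with the difference. -/

/-- `p` is nonzero and real-rooted, with simple roots at mutual distance greater than `b`. -/
structure StrictMesh (b : ℝ) (p : ℝ[X]) : Prop where
  ne_zero : p ≠ 0
  splits : p.Splits
  simple : ∀ x, p.IsRoot x → p.derivative.eval x ≠ 0
  gap : ∀ x y, p.IsRoot x → p.IsRoot y → x < y → x + b < y

theorem eval_mul_eval_pos {p : ℝ[X]} {x y : ℝ} (hxy : x ≤ y)
    (hp : ∀ t ∈ Set.Icc x y, p.eval t ≠ 0) : 0 < p.eval x * p.eval y := by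
  by_contra! h
  have hc : ContinuousOn (fun t => p.eval t) (Set.Icc x y) := p.continuous.continuousOn
  have : (0 : ℝ) ∈ (fun t => p.eval t) '' Set.Icc x y := by
    rcases mul_nonpos_iff.mp h with h | h
    · exact intermediate_value_Icc' hxy hc ⟨h.2, h.1⟩
    · exact intermediate_value_Icc hxy hc ⟨h.1, h.2⟩
  obtain ⟨t, ht, h0⟩ := this
  exact hp t ht h0

/-- With `s = p / (X - x)`, `Δ_b p (x) = s(x - b)` and `p'(x) = s(x)`; the gap condition leaves `s`
no root in `[x - b, x]`, so the signs agree. -/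
theorem StrictMesh.interlaces_diffLin {b : ℝ} (hb : 0 < b) {p : ℝ[X]} (hp : StrictMesh b p) :
    Interlaces (diffLin b p) p := by
  refine ⟨(natDegree_diffLin_le hb.ne' p).trans (Nat.sub_le _ _), fun x hx => ?_⟩
  have h1 : 0 < (p /ₘ (X - C x)).eval (x - b) * (p /ₘ (X - C x)).eval x := by
    refine eval_mul_eval_pos (by linarith) fun t ht h0 => ?_
    have ht0 : p.IsRoot t := by
      rw [IsRoot, eval_eq_mul_eval_divByMonic hx t, h0, mul_zero]
    rcases ht.2.lt_or_eq with h2 | h2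
    · have := hp.gap t x ht0 hx h2
      linarith [ht.1]
    · subst h2
      exact hp.simple t ht0 (by rw [eval_derivative_eq_eval_divByMonic ht0, h0])
  rw [eval_diffLin, hx.eq_zero, eval_eq_mul_eval_divByMonic hx (x - b),
    eval_derivative_eq_eval_divByMonic hx]
  convert h1 using 1
  field_simp
  ring

theorem StrictMesh.diffLin {b : ℝ} (hb : 0 < b) {p : ℝ[X]} (hp : StrictMesh b p)
    (hd : p.natDegree ≠ 0) : StrictMesh b (diffLin b p) := by
  have hI := hp.interlaces_diffLin hb
  have hW := hI.wronskian_pos hp.splits hd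
  refine ⟨?_, hI.splits hp.splits hd, fun x hx h0 => ?_, fun x y hx hy hxy => ?_⟩
  · intro h0
    have := hW 0
    simp [h0] at this
  · have := hW x
    rw [hx.eq_zero, h0, mul_zero, mul_zero, sub_zero] at this
    exact this.false
  · by_contra! hyx
    -- The translate `p(· - b) = p - b Δp` has the same Wronskian with `Δp` as `p`, so it has a root
    -- `t` between `x` and `y`. There `Δp / p = 1 / b > 0`, although `Δp / p` decreases from `0` on
    -- `[x, t]`.
    have hW' : ∀ t, 0 < (p - C b * MeshConvolution.diffLin b p).derivative.eval t *
        (MeshConvolution.diffLin b p).eval t - (p - C b * MeshConvolution.diffLin b p).eval t *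
          (MeshConvolution.diffLin b p).derivative.eval t := by
      intro t
      convert hW t using 1
      simp
      ring
    obtain ⟨t, ht, htr⟩ := exists_root_of_wronskian_pos hxy hW' hx hy
    rw [← comp_shift_eq hb.ne'] at htr
    have hroot : p.IsRoot (t - b) := by simpa using htr
    have hpx : p.eval x ≠ 0 := by
      intro h0
      have := hW x
      rw [hx.eq_zero, h0, mul_zero, zero_mul, sub_zero] at this
      exact this.false
    have hpt : b * (MeshConvolution.diffLin b p).eval t = p.eval t := by
      have := eval_sub_eq hb.ne' p t
      rw [hroot.eq_zero] at this
      linarith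
    have hne : x ≠ t := by
      rintro rfl
      rw [hx.eq_zero, mul_zero] at hpt
      exact hpx hpt.symm
    have hxt : x < t := lt_of_le_of_ne ht.1 hne
    have hlow : t - b < x := by
      refine lt_of_le_of_ne (by linarith [ht.2]) fun h => hpx ?_
      rw [← h]; exact hroot
    have hnr : ∀ u ∈ Set.Icc x t, p.eval u ≠ 0 := fun u hu h0 => by
      have := hp.gap (t - b) u hroot h0 (by linarith [hu.1])
      linarith [hu.2]
    have h1 := div_lt_div_of_wronskian_pos hxt hnr hW
    rw [hx.eq_zero, zero_div, ← hpt] at h1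
    have h2 : (MeshConvolution.diffLin b p).eval t ≠ 0 := fun h0 => by
      rw [h0, mul_zero] at hpt
      exact hnr t ⟨hxt.le, le_rfl⟩ hpt.symm
    have h3 : 0 < (MeshConvolution.diffLin b p).eval t /
        (b * (MeshConvolution.diffLin b p).eval t) := by
      rw [div_mul_cancel_right₀ h2]; positivity
    exact absurd h1 h3.not_gt

/-- Descent: if `x < y ≤ x + b` are roots, the translate `p(· - b)` has a root `t` in `[x, y]`, so
`t - b` is a root below `x` at distance at most `b`. The least such `x` yields a contradiction. -/
theorem Interlaces.strictMesh {b : ℝ} (hb : 0 < b) {p : ℝ[X]} (hp0 : p ≠ 0) (hp : p.Splits)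
    (h : Interlaces (MeshConvolution.diffLin b p) p) : StrictMesh b p := by
  have hnr : ∀ x, p.IsRoot x → ¬ p.IsRoot (x - b) := fun x hx hxb => by
    have := h.pos x hx
    rw [eval_diffLin, hx.eq_zero, hxb.eq_zero] at this
    simp at this
  refine ⟨hp0, hp, fun x hx h0 => ?_, ?_⟩
  · have := h.pos x hx
    simp [h0] at this
  by_contra! hbad
  set S : Set ℝ := {x | p.IsRoot x ∧ ∃ y, p.IsRoot y ∧ x < y ∧ y ≤ x + b} with hS
  have hfin : S.Finite := by
    refine (p.roots.toFinset.finite_toSet).subset fun x hx => ?_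
    simpa [hp0] using hx.1
  have hne : S.Nonempty := by
    obtain ⟨x, y, hx, hy, hxy, hyx⟩ := hbad
    exact ⟨x, hx, y, hy, hxy, hyx⟩
  obtain ⟨x, ⟨hx, y, hy, hxy, hyx⟩, hmin⟩ := hfin.exists_minimal hne
  have hd : p.natDegree ≠ 0 := fun h0 => by
    rw [eq_C_of_natDegree_eq_zero h0] at hx hp0
    simp at hx hp0
    exact hp0 hx
  have hW := h.wronskian_pos hp hd
  have hW' : ∀ t, 0 < (p - C b * MeshConvolution.diffLin b p).derivative.eval t * p.eval t -
      (p - C b * MeshConvolution.diffLin b p).eval t * p.derivative.eval t := by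
    intro t
    refine (mul_pos hb (hW t)).trans_eq ?_
    simp only [derivative_sub, derivative_C_mul, eval_sub, eval_mul, eval_C]
    ring
  obtain ⟨t, ht, htr⟩ := exists_root_of_wronskian_pos hxy hW' hx hy
  rw [← comp_shift_eq hb.ne'] at htr
  have hroot : p.IsRoot (t - b) := by simpa using htr
  have hxt : x ≠ t := by rintro rfl; exact hnr x hx hroot
  have hlt : t - b < x := by
    refine lt_of_le_of_ne (by linarith [ht.2]) fun h1 => ?_
    have h2 : y - b = x := by linarith [ht.2]
    exact hnr y hy (h2 ▸ hx)
  have hmem : t - b ∈ S := ⟨hroot, x, hx, hlt, by linarith [ht.1]⟩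
  exact hlt.not_ge (hmin hmem hlt.le)

/-- The coefficients of degree `m + 1` cancel, and at a root of `Δp` the sign is that of the
Wronskian of `p` and `Δp`. -/
theorem StrictMesh.interlaces_polarDiff {b : ℝ} (hb : 0 < b) {m : ℕ} {p : ℝ[X]}
    (hp : StrictMesh b p) (hd : p.natDegree = m + 1) :
    Interlaces (-polarDiff b (m + 1) p) (MeshConvolution.diffLin b p) := by
  obtain ⟨h1, h2⟩ := diffLin_natDegree_coeff hb.ne' m p hd.le
  refine ⟨?_, fun x hx => ?_⟩
  · rw [natDegree_neg, natDegree_diffLin hb.ne' hd, natDegree_le_iff_coeff_eq_zero]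
    intro N hN
    obtain ⟨N, rfl⟩ : ∃ k, N = k + 1 := ⟨N - 1, by omega⟩
    have h3 : (MeshConvolution.diffLin b p).coeff (N + 1) = 0 :=
      coeff_eq_zero_of_natDegree_lt (by omega)
    rw [polarDiff, sub_mul]
    simp only [coeff_sub, coeff_C_mul, coeff_X_mul, h3]
    rcases (Nat.lt_succ_iff.mp hN).eq_or_lt with rfl | hlt
    · rw [h2]; push_cast; ring
    · rw [coeff_eq_zero_of_natDegree_lt (p := p) (by omega),
        coeff_eq_zero_of_natDegree_lt (p := MeshConvolution.diffLin b p) (by omega)]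
      ring
  · have hW := (hp.interlaces_diffLin hb).wronskian_pos hp.splits (by omega) x
    rw [polarDiff]
    simp only [eval_neg, eval_sub, eval_mul, eval_C, hx.eq_zero] at hW ⊢
    push_cast
    nlinarith

theorem StrictMesh.divByMonic {b : ℝ} {p : ℝ[X]} (hp : StrictMesh b p) {x : ℝ}
    (hx : p.IsRoot x) : StrictMesh b (p /ₘ (X - C x)) := by
  have hmul := mul_divByMonic_eq_iff_isRoot.mpr hx
  have hroot : ∀ y, (p /ₘ (X - C x)).IsRoot y → p.IsRoot y := fun y hy => by
    rw [IsRoot, eval_eq_mul_eval_divByMonic hx y, hy.eq_zero, mul_zero]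
  refine ⟨fun h0 => hp.ne_zero ?_, hp.splits.of_dvd hp.ne_zero ⟨X - C x, ?_⟩,
    fun y hy h0 => hp.simple y (hroot y hy) ?_,
    fun y z hy hz => hp.gap y z (hroot y hy) (hroot z hz)⟩
  · rw [← hmul, h0, mul_zero]
  · rw [mul_comm, hmul]
  · rw [← hmul]
    simp [hy.eq_zero, h0]

end MeshConvolution

/-! ### Convolution preserves interlacing and strict mesh. -/

namespace MeshConvolution

theorem Interlaces.of_natDegree_eq_zero {p q : ℝ[X]} (hp0 : p ≠ 0) (hp : p.natDegree = 0)
    (hq : q.natDegree ≤ p.natDegree) : Interlaces q p := by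
  refine ⟨hq, fun x hx => ?_⟩
  rw [eq_C_of_natDegree_eq_zero hp] at hx hp0
  simp at hx hp0
  exact absurd hx hp0

/-- Convolution with a strict mesh polynomial of the same degree preserves interlacing. -/
theorem StrictMesh.additiveConv_interlaces {b : ℝ} (hb : 0 < b) (n : ℕ) : ∀ p r : ℝ[X],
    StrictMesh b p → StrictMesh b r → p.natDegree = n → r.natDegree = n →
      (additiveConv b n p r).natDegree = n ∧ additiveConv b n p r ≠ 0 ∧
        (additiveConv b n p r).Splits ∧ ∀ q, Interlaces q p →
          Interlaces (additiveConv b n q r) (additiveConv b n p r) := by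
  induction n with
  | zero =>
    intro p r hp hr hpn hrn
    have hdeg : ∀ q : ℝ[X], q.natDegree ≤ 0 → (additiveConv b 0 q r).natDegree ≤ 0 :=
      fun q hq => (natDegree_additiveConv_le hb.ne' 0 q r).trans hq
    have h0 : additiveConv b 0 p r ≠ 0 := by
      have hr0 := hr.ne_zero
      rw [eq_C_of_natDegree_eq_zero hrn] at hr0
      have : additiveConv b 0 p r = p * C (r.coeff 0) := by
        rw [additiveConv_eq, eq_C_of_natDegree_eq_zero hrn]
        simp
      rw [this]
      exact mul_ne_zero hp.ne_zero hr0
    have hd0 := Nat.le_zero.mp (hdeg p hpn.le)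
    refine ⟨hd0, h0, Splits.of_natDegree_eq_zero hd0, fun q hq => ?_⟩
    refine Interlaces.of_natDegree_eq_zero h0 hd0 ?_
    rw [hd0]
    exact hdeg q (hpn ▸ hq.natDegree_le)
  | succ m ih =>
    intro p r hp hr hpn hrn
    have hΔr : StrictMesh b (MeshConvolution.diffLin b r) := hr.diffLin hb (by omega)
    have hΔrn : (MeshConvolution.diffLin b r).natDegree = m := natDegree_diffLin hb.ne' hrn
    have hpolar := hr.interlaces_polarDiff hb hrn
    have key : ∀ x, p.IsRoot x → (additiveConv b (m + 1) p r).natDegree = m + 1 ∧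
        (additiveConv b (m + 1) p r).Splits ∧
        Interlaces (additiveConv b (m + 1) (p /ₘ (X - C x)) r) (additiveConv b (m + 1) p r) := by
      intro x hx
      set s := p /ₘ (X - C x) with hs
      have hsm : StrictMesh b s := hp.divByMonic hx
      have hsn : s.natDegree = m := by
        rw [hs, natDegree_divByMonic _ (monic_X_sub_C x), hpn, natDegree_X_sub_C]; omega
      -- The roles are swapped: `s` is the fixed factor, so that the interlacing of `-polarDiff`
      -- with `Δr` can be transported.
      obtain ⟨hAn, hA0, hA, hAI⟩ := ih _ s hΔr hsm hΔrn hsn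
      have hB := hAI _ hpolar
      have hneg : additiveConv b m (-polarDiff b (m + 1) r) s =
          -additiveConv b m (polarDiff b (m + 1) r) s := by
        rw [← convLin_apply, map_neg, convLin_apply]
      rw [hneg] at hB
      have hpolarn := hpolar.natDegree_le
      rw [natDegree_neg, hΔrn] at hpolarn
      have hP : additiveConv b (m + 1) p r =
          (X - C x) * additiveConv b m (MeshConvolution.diffLin b r) s +
            additiveConv b m (polarDiff b (m + 1) r) s := by
        rw [additiveConv_comm hb.ne' hΔrn.le hsn.le, additiveConv_comm hb.ne' hpolarn hsn.le,
          ← additiveConv_X_sub_C_mul hb.ne' x r hsn.le, hs, mul_divByMonic_eq_iff_isRoot.mpr hx]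
      rw [additiveConv_succ_left hb.ne' hsn.le, additiveConv_comm hb.ne' hsn.le hΔrn.le, hP]
      have := hB.X_sub_C_mul_add hA0 hA x
      rwa [hAn] at this
    obtain ⟨x₀, hx₀⟩ := hp.splits.exists_eval_eq_zero
      (fun h0 => (by omega : p.natDegree ≠ 0) (natDegree_eq_of_degree_eq_some h0))
    obtain ⟨hPn, hP, -⟩ := key x₀ hx₀
    have hP0 : additiveConv b (m + 1) p r ≠ 0 := fun h0 => by simp [h0] at hPn
    refine ⟨hPn, hP0, hP, fun q hq => ⟨?_, fun t ht => ?_⟩⟩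
    · rw [hPn]
      exact (natDegree_additiveConv_le hb.ne' _ q r).trans (hpn ▸ hq.natDegree_le)
    -- At a root of the convolution the `c p` part vanishes and each quotient contributes positively
    -- by `key`.
    · obtain ⟨c, w, hw, rfl⟩ := hq.exists_partialFraction hp.ne_zero hp.splits
      rw [← convLin_apply, map_add, map_sum, linearMap_C_mul, convLin_apply, eval_add, eval_mul,
        ht.eq_zero, mul_zero, zero_add, eval_finsetSum, Finset.sum_mul]
      refine Finset.sum_pos (fun x hx => ?_) ⟨x₀, by simpa [hp.ne_zero] using hx₀⟩
      have hx' : p.IsRoot x := by simpa [hp.ne_zero] using hx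
      rw [linearMap_C_mul, convLin_apply, eval_mul, eval_C, mul_assoc]
      exact mul_pos (hw x hx') ((key x hx').2.2.pos t ht)

theorem StrictMesh.additiveConv_of_natDegree_eq {b : ℝ} (hb : 0 < b) {n : ℕ} {p r : ℝ[X]}
    (hp : StrictMesh b p) (hr : StrictMesh b r) (hpn : p.natDegree = n) (hrn : r.natDegree = n) :
    StrictMesh b (additiveConv b n p r) := by
  obtain ⟨-, h0, hs, hI⟩ := StrictMesh.additiveConv_interlaces hb n p r hp hr hpn hrn
  refine Interlaces.strictMesh hb h0 hs ?_
  rw [diffLin_additiveConv]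
  exact hI _ (hp.interlaces_diffLin hb)

theorem additiveConv_zero_right (b : ℝ) (n : ℕ) (p : ℝ[X]) : additiveConv b n p 0 = 0 := by
  simp [additiveConv_eq]

/-- A factor of degree below `n` allows `n` to be lowered by differencing the other factor, which
keeps strict mesh unless it is constant; then the result is zero. -/
theorem StrictMesh.additiveConv {b : ℝ} (hb : 0 < b) {n : ℕ} : ∀ {p r : ℝ[X]},
    StrictMesh b p → StrictMesh b r → p.natDegree ≤ n → r.natDegree ≤ n →
    MeshConvolution.additiveConv b n p r = 0 ∨
      StrictMesh b (MeshConvolution.additiveConv b n p r) := by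
  induction n with
  | zero =>
    intro p r hp hr hpn hrn
    exact Or.inr (hp.additiveConv_of_natDegree_eq hb hr (by omega) (by omega))
  | succ m ih =>
    have hlt : ∀ {p r : ℝ[X]}, StrictMesh b p → StrictMesh b r → p.natDegree ≤ m →
        r.natDegree ≤ m + 1 → MeshConvolution.additiveConv b (m + 1) p r = 0 ∨
          StrictMesh b (MeshConvolution.additiveConv b (m + 1) p r) := by
      intro p r hp hr hpn hrn
      rw [additiveConv_succ_left hb.ne' hpn]
      by_cases hr0 : r.natDegree = 0
      · rw [diffLin_eq_zero hr0, additiveConv_zero_right]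
        exact Or.inl rfl
      · exact ih hp (hr.diffLin hb hr0) hpn ((natDegree_diffLin_le hb.ne' r).trans (by omega))
    intro p r hp hr hpn hrn
    rcases hpn.lt_or_eq with h | h
    · exact hlt hp hr (by omega) hrn
    rcases hrn.lt_or_eq with h' | h'
    · rw [additiveConv_comm hb.ne' hpn hrn]
      exact hlt hr hp (by omega) hpn
    · exact Or.inr (hp.additiveConv_of_natDegree_eq hb hr h h')

end MeshConvolution

/-! ### Passage to the limit `c → b`, by explicit root-product bounds. -/

namespace MeshConvolution

open Filter Topology

theorem normSq_aeval_of_splits {p : ℝ[X]} (hp : p.Splits) (x y : ℝ) :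
    Complex.normSq (aeval (⟨x, y⟩ : ℂ) p) =
      p.leadingCoeff ^ 2 * (p.roots.map fun u => (x - u) ^ 2 + y ^ 2).prod := by
  conv_lhs => rw [hp.eq_prod_roots]
  simp only [map_mul, aeval_C, map_multiset_prod, Multiset.map_map]
  congr 1
  · simp [sq]
  · congr 1
    refine Multiset.map_congr rfl fun u _ => ?_
    simp [Complex.normSq_apply]
    ring

theorem multiset_prod_map_le_pow_mul {s : Multiset ℝ} {f g : ℝ → ℝ} {K : ℝ} {n : ℕ} (hK : 1 ≤ K)
    (hs : s.card ≤ n) (hf : ∀ u ∈ s, 0 ≤ f u) (hg : ∀ u ∈ s, 0 ≤ g u)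
    (hfg : ∀ u ∈ s, f u ≤ K * g u) : (s.map f).prod ≤ K ^ n * (s.map g).prod := by
  have h0 : 0 ≤ (s.map g).prod := Multiset.prod_nonneg fun a ha => by
    obtain ⟨u, hu, rfl⟩ := Multiset.mem_map.mp ha
    exact hg u hu
  calc (s.map f).prod ≤ (s.map fun u => K * g u).prod := Multiset.prod_map_le_prod_map₀ _ _ hf hfg
    _ = K ^ s.card * (s.map g).prod := by simp [Multiset.prod_map_mul]
    _ ≤ K ^ n * (s.map g).prod := by gcongr

theorem normSq_aeval_mono_im {p : ℝ[X]} (hp : p.Splits) (x : ℝ) {y y' : ℝ} (h0 : 0 ≤ y)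
    (h : y ≤ y') : Complex.normSq (aeval (⟨x, y⟩ : ℂ) p) ≤
      Complex.normSq (aeval (⟨x, y'⟩ : ℂ) p) := by
  rw [normSq_aeval_of_splits hp, normSq_aeval_of_splits hp]
  refine mul_le_mul_of_nonneg_left (Multiset.prod_map_le_prod_map₀ _ _ (fun u _ => by positivity)
    fun u _ => ?_) (sq_nonneg _)
  gcongr

theorem sq_add_one_le {x u η : ℝ} (t : ℝ) (hη : 0 < η) (h : η ≤ |x - u|) :
    (x - u) ^ 2 + 1 ^ 2 ≤ (1 + 1 / η ^ 2) * ((x - u) ^ 2 + t ^ 2) := by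
  have h1 : η ^ 2 ≤ (x - u) ^ 2 := by
    rw [← sq_abs (x - u)]; gcongr
  have h2 : 1 ≤ 1 / η ^ 2 * (x - u) ^ 2 := by
    rw [one_div, inv_mul_eq_div, one_le_div (by positivity)]; exact h1
  have h3 : 0 ≤ (1 + 1 / η ^ 2) * t ^ 2 := by positivity
  nlinarith

/-- A real-rooted polynomial without roots near `x` is not small at `x`. -/
theorem normSq_aeval_le_of_far {p : ℝ[X]} (hp : p.Splits) {n : ℕ} (hn : p.natDegree ≤ n)
    {x η : ℝ} (hη : 0 < η) (h : ∀ u, p.IsRoot u → η ≤ |x - u|) :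
    Complex.normSq (aeval (⟨x, 1⟩ : ℂ) p) ≤
      (1 + 1 / η ^ 2) ^ n * Complex.normSq (aeval (⟨x, 0⟩ : ℂ) p) := by
  rw [normSq_aeval_of_splits hp, normSq_aeval_of_splits hp, mul_left_comm]
  refine mul_le_mul_of_nonneg_left (multiset_prod_map_le_pow_mul ?_ ?_ (fun u _ => by positivity)
    (fun u _ => by positivity) fun u hu => ?_) (sq_nonneg _)
  · have : 0 ≤ 1 / η ^ 2 := by positivity
    linarith
  · exact (card_roots' p).trans hn
  · exact sq_add_one_le 0 hη (h u (isRoot_of_mem_roots hu))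

/-- A real-rooted polynomial with at most one, simple, root near `x` is not too small at
`x + i t`. -/
theorem StrictMesh.normSq_aeval_le {b : ℝ} {p : ℝ[X]} (hp : StrictMesh b p) {n : ℕ}
    (hn : p.natDegree ≤ n) {η : ℝ} (hη : 0 < η) (hηb : 2 * η ≤ b) (x : ℝ) {t : ℝ} (ht : 0 < t)
    (ht1 : t ≤ 1) :
    Complex.normSq (aeval (⟨x, 1⟩ : ℂ) p) * t ^ 2 ≤
      (1 + 1 / η ^ 2) ^ n * Complex.normSq (aeval (⟨x, t⟩ : ℂ) p) := by
  have hK : 1 ≤ 1 + 1 / η ^ 2 := by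
    have : 0 ≤ 1 / η ^ 2 := by positivity
    linarith
  have ht2 : t ^ 2 ≤ 1 := by nlinarith
  have hcard := (card_roots' p).trans hn
  rw [normSq_aeval_of_splits hp.splits, normSq_aeval_of_splits hp.splits, mul_left_comm, mul_assoc]
  refine mul_le_mul_of_nonneg_left ?_ (sq_nonneg _)
  -- As `2 η ≤ b`, at most one root is this close; its factor costs `t²`, and all others are
  -- comparable at heights `t` and `1`.
  by_cases h : ∃ u ∈ p.roots, |x - u| < η
  · obtain ⟨u, hu, hxu⟩ := h
    have hnd := nodup_roots_of_derivative_ne_zero hp.ne_zero hp.simple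
    obtain ⟨s, hs⟩ := Multiset.exists_cons_of_mem hu
    rw [hs] at hnd hcard
    have hus := (Multiset.nodup_cons.mp hnd).1
    have hfar : ∀ v ∈ s, η ≤ |x - v| := by
      intro v hv
      by_contra! hxv
      have hvr : p.IsRoot v := isRoot_of_mem_roots (by rw [hs]; exact Multiset.mem_cons_of_mem hv)
      have hur : p.IsRoot u := isRoot_of_mem_roots hu
      rw [abs_lt] at hxu hxv
      rcases lt_trichotomy u v with h1 | h1 | h1
      · linarith [hp.gap u v hur hvr h1]
      · exact hus (h1 ▸ hv)
      · linarith [hp.gap v u hvr hur h1]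
    rw [hs, Multiset.map_cons, Multiset.map_cons, Multiset.prod_cons, Multiset.prod_cons]
    have h1 : ((x - u) ^ 2 + 1 ^ 2) * t ^ 2 ≤ (x - u) ^ 2 + t ^ 2 := by nlinarith [sq_nonneg (x - u)]
    have h2 := multiset_prod_map_le_pow_mul (s := s) (f := fun v => (x - v) ^ 2 + 1 ^ 2)
      (g := fun v => (x - v) ^ 2 + t ^ 2) (n := n) hK
      (by rw [Multiset.card_cons] at hcard; omega) (fun u _ => by positivity)
      (fun u _ => by positivity) (fun v hv => sq_add_one_le t hη (hfar v hv))
    have h3 : 0 ≤ (s.map fun v => (x - v) ^ 2 + 1 ^ 2).prod := Multiset.prod_nonneg fun a ha => by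
      obtain ⟨v, -, rfl⟩ := Multiset.mem_map.mp ha
      positivity
    calc _ = ((x - u) ^ 2 + 1 ^ 2) * t ^ 2 * (s.map fun v => (x - v) ^ 2 + 1 ^ 2).prod := by ring
      _ ≤ ((x - u) ^ 2 + t ^ 2) *
          ((1 + 1 / η ^ 2) ^ n * (s.map fun v => (x - v) ^ 2 + t ^ 2).prod) :=
        mul_le_mul h1 h2 h3 (by positivity)
      _ = _ := by ring
  · push Not at h
    have h2 := multiset_prod_map_le_pow_mul (s := p.roots) (f := fun v => (x - v) ^ 2 + 1 ^ 2)
      (g := fun v => (x - v) ^ 2 + t ^ 2) hK hcard (fun u _ => by positivity)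
      (fun u _ => by positivity) (fun v hv => sq_add_one_le t hη (h v hv))
    have h3 : 0 ≤ (p.roots.map fun v => (x - v) ^ 2 + 1 ^ 2).prod :=
      Multiset.prod_nonneg fun a ha => by
        obtain ⟨v, -, rfl⟩ := Multiset.mem_map.mp ha
        positivity
    exact (mul_le_of_le_one_right h3 ht2).trans h2

theorem eq_zero_of_aeval_eq_zero_on_segment {p : ℝ[X]} (x : ℝ) {y : ℝ} (hy : 0 < y)
    (h : ∀ t, 0 ≤ t → t ≤ y → aeval (⟨x, t⟩ : ℂ) p = 0) : p = 0 := by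
  have hinj : Function.Injective fun t : ℝ => (⟨x, t⟩ : ℂ) := fun s t hst => by
    simpa using congrArg Complex.im hst
  have h1 : p.map (algebraMap ℝ ℂ) = 0 := by
    refine eq_zero_of_infinite_isRoot _ (Set.Infinite.mono ?_
      ((Set.Icc_infinite hy).image hinj.injOn))
    rintro _ ⟨t, ht, rfl⟩
    rw [Set.mem_ofPred_eq, IsRoot, eval_map_algebraMap]
    exact h t ht.1 ht.2
  exact (Polynomial.map_eq_zero _).mp h1

section Closure

variable {l : Filter ℝ} [l.NeBot] {F : ℝ → ℝ[X]} {P : ℝ[X]} {n : ℕ} {b : ℝ}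

/-- For real-rooted polynomials the modulus grows with height above the real axis, so a zero of the
limit in the upper half-plane forces zeros on the whole segment below it. -/
theorem splits_of_tendsto (hF : ∀ᶠ c in l, (F c).Splits)
    (hlim : ∀ z : ℂ, Tendsto (fun c => aeval z (F c)) l (𝓝 (aeval z P))) : P.Splits := by
  rcases eq_or_ne P 0 with rfl | hP0
  · exact Splits.zero
  refine splits_of_forall_aeval_ne_zero fun z hz h0 => hP0 ?_
  refine eq_zero_of_aeval_eq_zero_on_segment z.re hz fun t ht htz => ?_
  have hn : ∀ w : ℂ, Tendsto (fun c => Complex.normSq (aeval w (F c))) l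
      (𝓝 (Complex.normSq (aeval w P))) :=
    fun w => (Complex.continuous_normSq.tendsto _).comp (hlim w)
  have h1 : Complex.normSq (aeval (⟨z.re, t⟩ : ℂ) P) ≤ Complex.normSq (aeval z P) := by
    refine le_of_tendsto_of_tendsto (hn _) (hn _) (hF.mono fun c hc => ?_)
    exact normSq_aeval_mono_im hc z.re ht htz
  rw [h0, map_zero] at h1
  exact Complex.normSq_eq_zero.mp (le_antisymm h1 (Complex.normSq_nonneg _))

/-- A limit of polynomials of bounded degree with mesh greater than `c`, as `c → b`, has mesh at
least `b`. -/
theorem isMesh_of_tendsto (hb : 0 < b) (hl : l ≤ 𝓝 b) (hdeg : ∀ᶠ c in l, (F c).natDegree ≤ n)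
    (hF : ∀ᶠ c in l, F c = 0 ∨ StrictMesh c (F c))
    (hlim : ∀ z : ℂ, Tendsto (fun c => aeval z (F c)) l (𝓝 (aeval z P))) : IsMesh b P := by
  have hP : P.Splits := splits_of_tendsto (hF.mono fun c hc => hc.elim
    (fun h => h ▸ Splits.zero) StrictMesh.splits) hlim
  refine ⟨hP, le_iInf fun x => le_iInf fun y => le_iInf fun hxy => EReal.coe_le_coe ?_⟩
  have hP0 : P ≠ 0 := by
    rintro rfl
    rw [roots_zero] at hxy
    simpa using Multiset.card_le_card hxy
  have hF' : ∀ᶠ c in l, StrictMesh c (F c) := by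
    have h1 := (hlim Complex.I).eventually_ne (aeval_ne_zero_of_splits hP0 hP (z := Complex.I)
      (by simp))
    filter_upwards [hF, h1] with c hc hc1
    refine hc.resolve_left fun h0 => hc1 ?_
    rw [h0, map_zero]
  have hn : ∀ w : ℂ, Tendsto (fun c => Complex.normSq (aeval w (F c))) l
      (𝓝 (Complex.normSq (aeval w P))) :=
    fun w => (Complex.continuous_normSq.tendsto _).comp (hlim w)
  have hpos : ∀ u : ℝ, 0 < Complex.normSq (aeval (⟨u, 1⟩ : ℂ) P) := fun u =>
    Complex.normSq_pos.mpr (aeval_ne_zero_of_splits hP0 hP (by simp))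
  have hzero : ∀ u : ℝ, P.IsRoot u → Complex.normSq (aeval (⟨u, 0⟩ : ℂ) P) = 0 := fun u hu => by
    have : (⟨u, 0⟩ : ℂ) = algebraMap ℝ ℂ u := rfl
    rw [this, aeval_algebraMap_apply, coe_aeval_eq_eval, hu.eq_zero, map_zero, map_zero]
  have hfar : ∀ u η : ℝ, 0 < η → P.IsRoot u →
      ∀ᶠ c in l, ∃ v, (F c).IsRoot v ∧ |u - v| < η := by
    intro u η hη hu
    have h1 := (hn ⟨u, 0⟩).const_mul ((1 + 1 / η ^ 2) ^ n)
    rw [hzero u hu, mul_zero] at h1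
    filter_upwards [h1.eventually_lt (hn ⟨u, 1⟩) (hpos u), hF', hdeg] with c hc hFc hdc
    by_contra! hv
    exact hc.not_ge (normSq_aeval_le_of_far hFc.splits hdc hη hv)
  have hmemx : P.IsRoot x := isRoot_of_mem_roots (Multiset.mem_of_le hxy (by simp))
  have hmemy : P.IsRoot y := isRoot_of_mem_roots (Multiset.mem_of_le hxy (by simp))
  by_cases hne : x = y
  -- A double root makes `|P(x + it)|²` of order `t⁴`, while strict mesh passes a lower bound of
  -- order `t²` to the limit. The radius `b / 4` works because eventually `c > b / 2`.
  · exfalso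
    subst hne
    have h2 : 2 ≤ rootMultiplicity x P := by
      classical
      rw [← count_roots]
      have := Multiset.count_le_of_le x hxy
      simpa using this
    obtain ⟨g, hg⟩ := (le_rootMultiplicity_iff hP0).mp h2
    set K := (1 + 1 / (b / 4) ^ 2) ^ n with hK
    have hbound : ∀ t : ℝ, 0 < t → t ≤ 1 → Complex.normSq (aeval (⟨x, 1⟩ : ℂ) P) ≤
        K * (t ^ 2 * Complex.normSq (aeval (⟨x, t⟩ : ℂ) g)) := by
      intro t ht ht1
      have h3 : Complex.normSq (aeval (⟨x, 1⟩ : ℂ) P) * t ^ 2 ≤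
          K * Complex.normSq (aeval (⟨x, t⟩ : ℂ) P) := by
        refine le_of_tendsto_of_tendsto ((hn _).mul_const _) ((hn _).const_mul _) ?_
        have hev : ∀ᶠ c in l, b / 2 < c := hl (lt_mem_nhds (by linarith))
        filter_upwards [hF', hdeg, hev] with c hc hdc hbc
        exact hc.normSq_aeval_le hdc (by linarith) (by linarith) x ht ht1
      have h4 : Complex.normSq (aeval (⟨x, t⟩ : ℂ) P) =
          t ^ 2 * (t ^ 2 * Complex.normSq (aeval (⟨x, t⟩ : ℂ) g)) := by
        rw [hg]
        simp [Complex.normSq_apply, pow_two]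
        ring
      rw [h4] at h3
      have ht2 : 0 < t ^ 2 := by positivity
      refine le_of_mul_le_mul_right (h3.trans_eq ?_) ht2
      ring
    have hcont : Continuous fun t : ℝ =>
        K * (t ^ 2 * Complex.normSq (aeval (⟨x, t⟩ : ℂ) g)) := by
      have h5 : Continuous fun t : ℝ => (⟨x, t⟩ : ℂ) :=
        Complex.equivRealProdCLM.symm.continuous.comp (by fun_prop : Continuous fun t : ℝ => (x, t))
      have h6 : Continuous fun t : ℝ => aeval (⟨x, t⟩ : ℂ) g := g.continuous_aeval.comp h5
      exact continuous_const.mul ((continuous_pow 2).mul (Complex.continuous_normSq.comp h6))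
    have h7 : Tendsto (fun t : ℝ => K * (t ^ 2 * Complex.normSq (aeval (⟨x, t⟩ : ℂ) g)))
        (𝓝[>] 0) (𝓝 0) := by
      have := hcont.tendsto 0
      simp only [ne_eq, OfNat.ofNat_ne_zero, not_false_eq_true, zero_pow, zero_mul, mul_zero] at this
      exact this.mono_left nhdsWithin_le_nhds
    refine (hpos x).not_ge (ge_of_tendsto h7 ?_)
    filter_upwards [Ioc_mem_nhdsGT (zero_lt_one' ℝ)] with t ht
    exact hbound t ht.1 ht.2
  · by_contra! hlt
    have habs : 0 < |x - y| := abs_pos.mpr (sub_ne_zero.mpr hne)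
    -- The first bound on `η` keeps the approximating roots `u`, `v` distinct; the second puts them
    -- closer than `c`.
    obtain ⟨η, hη, hη1, hη2⟩ : ∃ η, 0 < η ∧ 2 * η ≤ |x - y| ∧ |x - y| + 2 * η < b := by
      refine ⟨min (|x - y| / 2) ((b - |x - y|) / 4), lt_min (by linarith) (by linarith), ?_, ?_⟩
      · linarith [min_le_left (|x - y| / 2) ((b - |x - y|) / 4)]
      · linarith [min_le_right (|x - y| / 2) ((b - |x - y|) / 4)]
    have hev : ∀ᶠ c in l, |x - y| + 2 * η < c := hl (lt_mem_nhds hη2)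
    obtain ⟨c, hc, ⟨u, hu, hxu⟩, ⟨v, hv, hyv⟩, hcb⟩ :=
      (hF'.and ((hfar x η hη hmemx).and ((hfar y η hη hmemy).and hev))).exists
    have h1 : |x - y| < |u - v| + 2 * η := by
      calc |x - y| = |(x - u) + (u - v) - (y - v)| := by congr 1; ring
        _ ≤ |x - u| + |u - v| + |y - v| := (abs_sub _ _).trans (by gcongr; exact abs_add_le _ _)
        _ < _ := by linarith
    have h2 : |u - v| < c := by
      calc |u - v| = |(x - y) - (x - u) + (y - v)| := by congr 1; ring
        _ ≤ |x - y| + |x - u| + |y - v| := (abs_add_le _ _).trans (by gcongr; exact abs_sub _ _)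
        _ < _ := by linarith
    rw [abs_lt] at h2
    rcases lt_trichotomy u v with h3 | h3 | h3
    · linarith [hc.gap u v hu hv h3]
    · rw [h3, sub_self, abs_zero] at h1
      linarith
    · linarith [hc.gap v u hv hu h3]

end Closure

theorem IsMesh.strictMesh {b c : ℝ} (hc : c < b) (hc0 : 0 < c) {p : ℝ[X]} (hp0 : p ≠ 0)
    (hp : IsMesh b p) : StrictMesh c p := by
  classical
  have hmesh : ∀ x y : ℝ, ({x, y} : Multiset ℝ) ≤ p.roots → b ≤ |x - y| := fun x y h =>
    EReal.coe_le_coe_iff.mp (hp.2.trans (iInf_le_of_le x (iInf_le_of_le y (iInf_le _ h))))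
  refine ⟨hp0, hp.1, fun x hx h0 => ?_, fun x y hx hy hxy => ?_⟩
  · have h1 := (one_lt_rootMultiplicity_iff_isRoot hp0).mpr ⟨hx, h0⟩
    rw [← count_roots] at h1
    have h2 := hmesh x x (by
      have : ({x, x} : Multiset ℝ) = Multiset.replicate 2 x := rfl
      rw [this]
      exact Multiset.le_count_iff_replicate_le.mp h1)
    rw [sub_self, abs_zero] at h2
    linarith
  · have h2 := hmesh x y (by
      refine (Multiset.le_iff_subset (by simpa using hxy.ne)).mpr fun u hu => ?_
      rw [mem_roots hp0]
      rcases (by simpa using hu : u = x ∨ u = y) with rfl | rfl <;> assumption)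
    rw [abs_sub_comm, abs_of_pos (by linarith)] at h2
    linarith

theorem aeval_diffLin (b : ℝ) (p : ℝ[X]) (z : ℂ) :
    aeval z (diffLin b p) = (b : ℂ)⁻¹ * (aeval z p - aeval (z - b) p) := by
  simp [diffLin_apply, aeval_comp]

/-- Continuity is joint in step and point because each difference also evaluates at a point moved by
the step. -/
theorem continuousAt_aeval_pow_diffLin {b : ℝ} (hb : b ≠ 0) (p : ℝ[X]) (k : ℕ) : ∀ z : ℂ,
    ContinuousAt (fun v : ℝ × ℂ => aeval v.2 ((diffLin v.1 ^ k) p)) (b, z) := by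
  induction k with
  | zero =>
    intro z
    simp only [pow_zero, Module.End.one_apply]
    exact (p.continuous_aeval.comp continuous_snd).continuousAt
  | succ k ih =>
    intro z
    simp only [pow_diffLin_succ', aeval_diffLin]
    have h1 : ContinuousAt (fun v : ℝ × ℂ => ((v.1 : ℂ))⁻¹) (b, z) :=
      (Complex.continuous_ofReal.comp continuous_fst).continuousAt.inv₀ (by simpa using hb)
    have h2 : ContinuousAt (fun v : ℝ × ℂ => (v.1, v.2 - (v.1 : ℂ))) (b, z) :=
      (continuous_fst.prodMk (continuous_snd.sub
        (Complex.continuous_ofReal.comp continuous_fst))).continuousAt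
    have h3 := ContinuousAt.comp (f := fun v : ℝ × ℂ => (v.1, v.2 - (v.1 : ℂ)))
      (g := fun v : ℝ × ℂ => aeval v.2 ((diffLin v.1 ^ k) p)) (ih (z - b)) h2
    exact h1.mul ((ih z).sub h3)

theorem tendsto_aeval_additiveConv {b : ℝ} (hb : b ≠ 0) (n : ℕ) (p r : ℝ[X]) (z : ℂ) :
    Tendsto (fun c => aeval z (additiveConv c n p r)) (𝓝 b)
      (𝓝 (aeval z (additiveConv b n p r))) := by
  have h0 : ∀ q : ℝ[X], ((q.eval 0 : ℝ) : ℂ) = aeval (0 : ℂ) q := fun q => by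
    rw [← coe_aeval_eq_eval, ← Complex.coe_algebraMap, ← aeval_algebraMap_apply, map_zero]
  have hk : ∀ (q : ℝ[X]) (k : ℕ) (w : ℂ),
      Tendsto (fun c => aeval w ((diffLin c ^ k) q)) (𝓝 b) (𝓝 (aeval w ((diffLin b ^ k) q))) :=
    fun q k w => ContinuousAt.comp (f := fun c : ℝ => (c, w))
      (continuousAt_aeval_pow_diffLin hb q k w) (by fun_prop)
  simp only [additiveConv_eq, map_sum, map_mul, aeval_C, Complex.coe_algebraMap, h0]
  exact tendsto_finsetSum _ fun k _ => (hk p k z).mul (hk r (n - k) 0)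

theorem additiveConv_zero_left (b : ℝ) (n : ℕ) (r : ℝ[X]) : additiveConv b n 0 r = 0 := by
  simp [additiveConv_eq]

theorem isMesh_zero (b : ℝ) : IsMesh b 0 := by
  refine ⟨Splits.zero, le_iInf fun x => le_iInf fun y => le_iInf fun h => ?_⟩
  rw [roots_zero] at h
  simpa using Multiset.card_le_card h

end MeshConvolution

theorem theorem1p2 (b : ℝ) (hb : 0 < b) (n : ℕ) (p r : ℝ[X])
    (hpn : p.natDegree ≤ n) (hrn : r.natDegree ≤ n)
    (hp : MeshConvolution.IsMesh b p) (hr : MeshConvolution.IsMesh b r) :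
    MeshConvolution.IsMesh b (MeshConvolution.additiveConv b n p r) := by
  open MeshConvolution Filter Topology in
  rcases eq_or_ne p 0 with rfl | hp0
  · rw [additiveConv_zero_left]; exact isMesh_zero b
  rcases eq_or_ne r 0 with rfl | hr0
  · rw [additiveConv_zero_right]; exact isMesh_zero b
  have hpos : ∀ᶠ c in 𝓝[<] b, 0 < c := nhdsWithin_le_nhds (lt_mem_nhds hb)
  -- The approach is from the left: mesh at least `b` is strict mesh for every `0 < c < b`.
  refine isMesh_of_tendsto (l := 𝓝[<] b) (F := fun c => additiveConv c n p r) (n := n) hb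
    nhdsWithin_le_nhds ?_ ?_
    fun z => (tendsto_aeval_additiveConv hb.ne' n p r z).mono_left nhdsWithin_le_nhds
  · filter_upwards [hpos] with c hc
    exact (natDegree_additiveConv_le hc.ne' n p r).trans hpn
  · filter_upwards [hpos, self_mem_nhdsWithin] with c hc hcb
    exact (hp.strictMesh hcb hc hp0).additiveConv hc (hr.strictMesh hcb hc hr0) hpn hrn
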